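/- **Setting.** Let $\mathbf M$ be a compact metric space with distance $\rho$ and let a group $G$ act on $\mathbf M$ so that, for all $x,y,x',y'\in\mathbf M$, $\rho(x,y)=\rho(x',y')$ if and only if $gx=x'$, $gy=y'$ for some $g\in G$ ($\mathbf M$ is a compact 2-point-homogeneous space). Let $\mu$ be the $G$-invariant Borel probability measure on $\mathbf M$. Let $\tau(x,y)=F(\rho(x,y))$ for a function $F:\mathbb R\to\mathbb R$, and put $\tau_0=\tau(x,x)=F(0)$, $T=\{\tau(x,y):x,y\in\mathbf M\}$. Let $\Phi_k$, $0\le k<K$ ($K\le\infty$; $K$ is finite exactly when $\mathbf M$ is finite), be the zonal spherical functions of $\mathbf M$, and assume that $\Phi_k(t)=\sum_{\ell=0}^k p_{k\ell}t^\ell$ is a polynomial of degree $k$. That is, there are finite-dimensional, pairwise $L^2(\mu)$-orthogonal, irreducible $G$-invariant spaces $V_k$ ($k<K$) of continuous real functions on $\mathbf M$ whose sum is dense in $C(\mathbf M)$, and $\Phi_k(\tau(x,y))$ is the multiple of the reproducing kernel of $V_k\subset L^2(\mu)$ normalized by $\Phi_k(\tau_0)=1$. Let $a,b$ be real and $S=T\cap[a,b]$.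 A finite set $C\subset\mathbf M$ is an $S$-code if $\tau(x,y)\in S$ for all distinct $x,y\in C$; for $\mathbf\Pi\subseteq\mathbf M$ let $A(\mathbf\Pi,S)$ be the largest cardinality (the supremum of the cardinalities) of the $S$-codes contained in $\mathbf\Pi$. Let $q_1,\dots,q_r\in\mathbf M$ (the set $C_0$), and let $\Pi_1,\dots,\Pi_d\subseteq\mathbf M$ be pairwise disjoint with $\mathbf\Pi\subseteq\Pi_1\cup\dots\cup\Pi_d$. Let $\alpha_{ij},\beta_{ij}\in[-\infty,\infty]$ be such that $\alpha_{ij}\le\tau(q_i,v)\le\beta_{ij}$ for all $v\in\Pi_j$, $1\le i\le r$, $1\le j\le d$, and let $a_{ij},b_{ij}\in\mathbb R$ ($i\le j$) be such that for all $u\in\Pi_i$, $v\in\Pi_j$, $u\ne v$, if $\tau(u,v)\in[a,b]$ then $\tau(u,v)\in[a_{ij},b_{ij}]$. For an integer $m\ge1$ and numbers $s_0,\dots,s_{2m-1}$ let $H_m(s_0,\dots,s_{2m-1},[\alpha,\beta])$ be the block diagonal matrix with the three $m\times m$ blocks $$(s_{i+j})_{0\le i,j<m},\qquad (s_{i+j+1}-\alpha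 s_{i+j})_{0\le i,j<m},\qquad (\beta s_{i+j}-s_{i+j+1})_{0\le i,j<m},$$ where the block of an infinite endpoint is omitted. **The problem $\widehat{SDP}$.** Fix $m\ge1$. The variables are real numbers $c_j$, $x^{(k)}_{ij}=x^{(k)}_{ji}$ $(1\le i,j\le d)$ and $y^{(k)}_{ij}$ $(1\le i\le r,\ 1\le j\le d)$, for $0\le k\le 2m-1$. Let $Ad(c,\mathbf x,\mathbf y)$ be a square real matrix whose entries are affine functions of the variables (possibly of size $0$), such that $Ad\succeq0$ holds at the values $$c_j=|C_j|,\qquad x^{(k)}_{ij}=\sum_{u\in C_i}\sum_{v\in C_j}\tau(u,v)^k,\qquad y^{(k)}_{ij}=\sum_{v\in C_j}\tau(q_i,v)^k,\qquad C_j=C\cap\Pi_j,$$ of every $S$-code $C\subset\mathbf\Pi$. Here and below $0^0=1$, and $X\succeq0$ means that $X$ is symmetric and positive semidefinite. The problem is to maximize $c=c_1+\dots+c_d$ subject to: 1. $\Gamma_k(\mathbf x,\mathbf y)\succeq0$ for all $0\le k\le 2m-1$ with $k<K$, where $$\Gamma_k=\begin{pmatrix}\bigl(\Phi_k(\tau(q_i,q_j))\bigr)_{i,j\le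 r}&\bigl(\sum_\ell p_{k\ell}\,y^{(\ell)}_{ij}\bigr)_{i\le r,\,j\le d}\\ \bigl(\sum_\ell p_{k\ell}\,y^{(\ell)}_{ji}\bigr)_{i\le d,\,j\le r}&\bigl(\sum_\ell p_{k\ell}\,x^{(\ell)}_{ij}\bigr)_{i,j\le d}\end{pmatrix};$$ 2. $H_m(y^{(0)}_{ij},\dots,y^{(2m-1)}_{ij},[\alpha_{ij},\beta_{ij}])\succeq0$ for $1\le i\le r$, $1\le j\le d$; 3. $H_m(x^{(0)}_{ij},\dots,x^{(2m-1)}_{ij},[a_{ij},b_{ij}])\succeq0$ for $1\le i<j\le d$; 4. $H_m(z_{0,i},\dots,z_{2m-1,i},[a_{ii},b_{ii}])\succeq0$ for $1\le i\le d$, where $z_{k,i}=x^{(k)}_{ii}-c_i\tau_0^k$; 5. $Ad(c,\mathbf x,\mathbf y)\succeq0$; 6. $y^{(0)}_{ij}=c_j$ for all $i,j$, $c_j\ge0$ for all $j$, and $$\begin{pmatrix}1&c_1&\cdots&c_d\\ c_1&x^{(0)}_{11}&\cdots&x^{(0)}_{1d}\\ \vdots&\vdots&\ddots&\vdots\\ c_d&x^{(0)}_{1d}&\cdots&x^{(0)}_{dd}\end{pmatrix}\succeq0.$$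 Let $c^*(m,C_0,d,\{\Pi_i\},Ad)\in[-\infty,\infty]$ be the maximal value (the supremum) of $c$ over all feasible points. **Theorem.** $\displaystyle A(\mathbf\Pi,S)\le c^*(m,C_0,d,\{\Pi_i\},Ad).$ -/

import Mathlib

open MeasureTheory Polynomial
open scoped ENNReal

namespace CodeSDP

/-! ### Two-point-homogeneous spaces and zonal spherical functions -/

/-- The metric of `M` is strongly invariant under the action of `G`: two pairs of points are at the
same distance if and only if some element of `G` takes one pair to the other. -/
def IsTwoPointHomogeneous (G M : Type*) [Group G] [MetricSpace M] [MulAction G M] : Prop :=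
  ∀ x y x' y' : M, dist x y = dist x' y' ↔ ∃ g : G, g • x = x' ∧ g • y = y'

/-- A space of continuous functions on `M` that is stable under all translations `f ↦ f (g • ·)`. -/
def IsInvariantSubspace (G : Type*) {M : Type*} [Group G] [MetricSpace M] [MulAction G M]
    (V : Submodule ℝ C(M, ℝ)) : Prop :=
  ∀ g : G, ∀ f ∈ V, ∃ h ∈ V, ∀ x, h x = f (g • x)

/-- `V` is an irreducible `G`-module: nonzero, invariant, without proper nonzero invariant
subspaces. -/
structure IsIrreducibleSubspace (G : Type*) {M : Type*} [Group G] [MetricSpace M] [MulAction G M]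
    (V : Submodule ℝ C(M, ℝ)) : Prop where
  ne_bot : V ≠ ⊥
  invariant : IsInvariantSubspace G V
  eq_bot_or_eq : ∀ W : Submodule ℝ C(M, ℝ), W ≤ V → IsInvariantSubspace G W → W = ⊥ ∨ W = V

/-- `τ(x, y) = F(ρ(x, y))`, where `ρ` is the distance of `M`. -/
def tau {M : Type*} [MetricSpace M] (F : ℝ → ℝ) (x y : M) : ℝ := F (dist x y)

/-- `φ` is the zonal spherical function of the finite-dimensional space `V` of continuous functions:
`(x, y) ↦ φ(τ(x, y))` is the multiple of the reproducing kernel of `V ⊆ L²(μ)` that is equal to `1`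
on the diagonal. (The multiple is then `1 / dim V`.) -/
structure IsZonalSpherical {M : Type*} [MetricSpace M] [MeasurableSpace M] (μ : Measure M)
    (F : ℝ → ℝ) (V : Submodule ℝ C(M, ℝ)) (φ : ℝ[X]) : Prop where
  finiteDimensional : FiniteDimensional ℝ V
  mem : ∀ y : M, ∃ z ∈ V, ∀ x : M, z x = φ.eval (tau F x y)
  reproducing : ∃ κ : ℝ, ∀ f ∈ V, ∀ y : M, f y = κ * ∫ x, f x * φ.eval (tau F x y) ∂μ
  normalized : φ.eval (F 0) = 1

/-- `Φ_k`, `k < K` (where `K ≤ ∞`), are the zonal spherical functions of `M`, and `Φ_k` is a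
polynomial of degree `k` in `τ`. That is, the functions on `M` decompose into pairwise orthogonal
irreducible `G`-modules `V_k`, `k < K`, whose zonal spherical functions are the `Φ_k`.
The number `K` of the modules is infinite for the infinite spaces and finite for the finite ones. -/
def IsZonalFamily (G : Type*) {M : Type*} [Group G] [MetricSpace M] [MulAction G M]
    [MeasurableSpace M] [CompactSpace M] (μ : Measure M) (F : ℝ → ℝ) (K : ℕ∞) (Φ : ℕ → ℝ[X]) :
    Prop :=
  ∃ V : ℕ → Submodule ℝ C(M, ℝ),
    (∀ k : ℕ, (k : ℕ∞) < K → IsIrreducibleSubspace G (V k)) ∧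
    (∀ j k : ℕ, (j : ℕ∞) < K → (k : ℕ∞) < K → j ≠ k →
      ∀ f ∈ V j, ∀ h ∈ V k, ∫ x, f x * h x ∂μ = 0) ∧
    (⨆ (k : ℕ) (_ : (k : ℕ∞) < K), V k).topologicalClosure = ⊤ ∧
    (∀ k : ℕ, (k : ℕ∞) < K → IsZonalSpherical μ F (V k) (Φ k)) ∧
    (∀ k : ℕ, (k : ℕ∞) < K → (Φ k).natDegree = k)

/-! ### Codes -/

/-- `T`, the set of all values of `τ`. -/
def tauValues (M : Type*) [MetricSpace M] (F : ℝ → ℝ) : Set ℝ := {t | ∃ x y : M, tau F x y = t}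

/-- A finite set `C` is an `S`-code if `τ(x, y) ∈ S` for all distinct `x, y ∈ C`. -/
def IsCode {M : Type*} [MetricSpace M] (F : ℝ → ℝ) (S : Set ℝ) (C : Finset M) : Prop :=
  ∀ x ∈ C, ∀ y ∈ C, x ≠ y → tau F x y ∈ S

/-- `A(Π, S)`, the largest cardinality of an `S`-code contained in `Π`. -/
noncomputable def maxCode {M : Type*} [MetricSpace M] (F : ℝ → ℝ) (S : Set ℝ) (P : Set M) : ℕ∞ :=
  ⨆ (C : Finset M) (_ : (C : Set M) ⊆ P ∧ IsCode F S C), (C.card : ℕ∞)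

/-! ### The matrices `H_m` -/

/-- `R_m = (s_{i+j})`, with rows and columns numbered from `0`. -/
def hankelR (m : ℕ) (s : Fin (2 * m) → ℝ) : Matrix (Fin m) (Fin m) ℝ :=
  Matrix.of fun i j => s ⟨i + j, by omega⟩

/-- `F_m^+(a) = (s_{i+j+1} - a s_{i+j})`; for infinite `a` there is no such condition, and the block
is `0`. -/
noncomputable def hankelPlus (m : ℕ) (s : Fin (2 * m) → ℝ) (a : EReal) :
    Matrix (Fin m) (Fin m) ℝ := by
  classical
  exact if a = ⊥ ∨ a = ⊤ then 0 else
    Matrix.of fun i j => s ⟨i + j + 1, by omega⟩ - a.toReal * s ⟨i + j, by omega⟩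

/-- `F_m^-(b) = (b s_{i+j} - s_{i+j+1})`; for infinite `b` there is no such condition, and the block
is `0`. -/
noncomputable def hankelMinus (m : ℕ) (s : Fin (2 * m) → ℝ) (b : EReal) :
    Matrix (Fin m) (Fin m) ℝ := by
  classical
  exact if b = ⊥ ∨ b = ⊤ then 0 else
    Matrix.of fun i j => b.toReal * s ⟨i + j, by omega⟩ - s ⟨i + j + 1, by omega⟩

/-- `H_m(s_0, …, s_{2m-1}, [a, b])`, the block diagonal matrix of `R_m`, `F_m^+(a)`, `F_m^-(b)`. -/
noncomputable def hankelH (m : ℕ) (s : Fin (2 * m) → ℝ) (a b : EReal) :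
    Matrix (Fin m ⊕ (Fin m ⊕ Fin m)) (Fin m ⊕ (Fin m ⊕ Fin m)) ℝ :=
  Matrix.fromBlocks (hankelR m s) 0 0
    (Matrix.fromBlocks (hankelPlus m s a) 0 0 (hankelMinus m s b))

/-! ### The semidefinite program -/

/-- The variables `c_j`, `x_{ij}^{(k)}` and `y_{ij}^{(k)}`, `0 ≤ k ≤ 2m - 1`, as a triple
`(c, x, y)`. The number `x_{ij}^{(k)}` is `x k i j`. -/
abbrev Vars (m r d : ℕ) : Type :=
  (Fin d → ℝ) × (Fin (2 * m) → Fin d → Fin d → ℝ) × (Fin (2 * m) → Fin r → Fin d → ℝ)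

/-- The values of the variables that come from a finite set `C`: with `C_j = C ∩ Π_j`,
`c_j = |C_j|`, `x_{ij}^{(k)} = ∑_{u ∈ C_i, v ∈ C_j} τ(u,v)^k`,
`y_{ij}^{(k)} = ∑_{v ∈ C_j} τ(q_i,v)^k`. -/
noncomputable def codeVars {M : Type*} [MetricSpace M] (F : ℝ → ℝ) (m : ℕ) {r d : ℕ}
    (q : Fin r → M) (P : Fin d → Set M) (C : Finset M) : Vars m r d := by
  classical
  exact
    (fun j => ((C.filter fun v => v ∈ P j).card : ℝ),
     fun k i j => ∑ u ∈ C.filter (fun u => u ∈ P i), ∑ v ∈ C.filter (fun v => v ∈ P j),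
       tau F u v ^ (k : ℕ),
     fun k i j => ∑ v ∈ C.filter (fun v => v ∈ P j), tau F (q i) v ^ (k : ℕ))

/-- `Γ_k(x, y)`, where `φ = Φ_k = ∑ p_{kℓ} t^ℓ`: the entries are `Φ_k(τ(q_i, q_j))`,
`∑_ℓ p_{kℓ} y_{ij}^{(ℓ)}` and `∑_ℓ p_{kℓ} x_{ij}^{(ℓ)}`. -/
noncomputable def gammaMatrix {M : Type*} [MetricSpace M] (F : ℝ → ℝ) {m r d : ℕ}
    (φ : ℝ[X]) (q : Fin r → M) (v : Vars m r d) : Matrix (Fin r ⊕ Fin d) (Fin r ⊕ Fin d) ℝ :=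
  Matrix.fromBlocks
    (Matrix.of fun i j => φ.eval (tau F (q i) (q j)))
    (Matrix.of fun i j => ∑ l : Fin (2 * m), φ.coeff l * v.2.2 l i j)
    (Matrix.of fun j i => ∑ l : Fin (2 * m), φ.coeff l * v.2.2 l i j)
    (Matrix.of fun i j => ∑ l : Fin (2 * m), φ.coeff l * v.2.1 l i j)

/-- The matrix with the corner `1`, the border `c_1, …, c_d` and the entries `h_{ij}`. -/
def borderedMatrix {d : ℕ} (c : Fin d → ℝ) (h : Fin d → Fin d → ℝ) :
    Matrix (Unit ⊕ Fin d) (Unit ⊕ Fin d) ℝ :=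
  Matrix.fromBlocks (Matrix.of fun _ _ => 1) (Matrix.of fun _ j => c j)
    (Matrix.of fun i _ => c i) (Matrix.of h)

/-- The data of the program: `τ = F(ρ)`; `Φ_k`, `k < K`; `m > 0`; the points `q_i`; the bounds
`[α_{ij}, β_{ij}]` (possibly infinite) on `τ(q_i, ·)` in `Π_j`; the bounds `[a_{ij}, b_{ij}]` on `τ`
between `Π_i` and `Π_j`; and the additional constraints, a linear matrix inequality
`Ad(c, x, y) ⪰ 0` of some size `N` (`N = 0` if there are none). -/
structure Program (M : Type*) (r d : ℕ) where
  F : ℝ → ℝ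
  K : ℕ∞
  Φ : ℕ → ℝ[X]
  m : ℕ
  m_pos : 0 < m
  q : Fin r → M
  α : Fin r → Fin d → EReal
  β : Fin r → Fin d → EReal
  a : Fin d → Fin d → ℝ
  b : Fin d → Fin d → ℝ
  N : ℕ
  Ad : Vars m r d →ᵃ[ℝ] Matrix (Fin N) (Fin N) ℝ

namespace Program

variable {M : Type*} {r d : ℕ}

/-- The index `k = 0` of the moments. -/
def zeroIdx (D : Program M r d) : Fin (2 * D.m) := ⟨0, Nat.mul_pos Nat.two_pos D.m_pos⟩

/-- The constraints of the program. -/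
structure Feasible [MetricSpace M] (D : Program M r d) (v : Vars D.m r d) : Prop where
  x_symm : ∀ k i j, v.2.1 k i j = v.2.1 k j i
  gamma : ∀ k : Fin (2 * D.m), ((k : ℕ) : ℕ∞) < D.K →
    (gammaMatrix D.F (D.Φ k) D.q v).PosSemidef
  hankel_y : ∀ i j,
    (hankelH D.m (fun k => v.2.2 k i j) (D.α i j) (D.β i j)).PosSemidef
  hankel_x : ∀ i j, i < j →
    (hankelH D.m (fun k => v.2.1 k i j) (D.a i j : EReal) (D.b i j : EReal)).PosSemidef
  hankel_diag : ∀ i,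
    (hankelH D.m (fun k => v.2.1 k i i - v.1 i * D.F 0 ^ (k : ℕ))
      (D.a i i : EReal) (D.b i i : EReal)).PosSemidef
  ad : (D.Ad v).PosSemidef
  y_zero : ∀ i j, v.2.2 D.zeroIdx i j = v.1 j
  c_nonneg : ∀ j, 0 ≤ v.1 j
  bordered : (borderedMatrix v.1 (v.2.1 D.zeroIdx)).PosSemidef

/-- `c^*`, the maximal value of `c = c_1 + … + c_d` subject to the constraints, as a supremum in the
extended real numbers. -/
noncomputable def cStar [MetricSpace M] (D : Program M r d) : EReal :=
  ⨆ (v : Vars D.m r d) (_ : D.Feasible v), ((∑ j, v.1 j : ℝ) : EReal)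

end Program

end CodeSDP

namespace CodeSDP

/-! The program is a relaxation: every `S`-code `C` in `P` yields a feasible point with objective
value `|C|`, so `|C|` is at most the supremum. Feasibility has two sources. Moments of finitely many
points of an interval make each Hankel block a nonnegative combination of rank-one matrices
(`posSemidef_hankelH`). A zonal function is, up to a nonnegative factor, a reproducing kernel, so
its sums over pairs of finite sets form a Gram matrix in `L²(μ)`
(`IsZonalSpherical.posSemidef_sum`); taking the sets `{q_i}` and `C_j` gives `Γ_k`. The objective
equals `|C|` because the `Π_j` are disjoint and cover the code. -/

/-! ### Hankel matrices of finite point sets -/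

theorem posSemidef_fromBlocks_diag {p q : Type*} [Fintype p] [Fintype q]
    {A : Matrix p p ℝ} {B : Matrix q q ℝ} (hA : A.PosSemidef) (hB : B.PosSemidef) :
    (Matrix.fromBlocks A 0 0 B).PosSemidef := by
  refine .of_dotProduct_mulVec_nonneg ?_ fun x => ?_
  · exact hA.1.fromBlocks (by simp) hB.1
  · have h₁ := hA.dotProduct_mulVec_nonneg (x ∘ Sum.inl)
    have h₂ := hB.dotProduct_mulVec_nonneg (x ∘ Sum.inr)
    simp only [star_trivial, dotProduct, Function.comp_apply] at h₁ h₂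
    simpa [Matrix.fromBlocks_mulVec, dotProduct, Fintype.sum_sum_type] using add_nonneg h₁ h₂

theorem posSemidef_of_weighted_sum {n ι : Type*} [Fintype n] (s : Finset ι) (w : ι → ℝ)
    (hw : ∀ p ∈ s, 0 ≤ w p) (f : ι → n → ℝ) (A : Matrix n n ℝ)
    (hA : ∀ i j, A i j = ∑ p ∈ s, w p * (f p i * f p j)) : A.PosSemidef := by
  have h : A = ∑ p ∈ s, w p • Matrix.vecMulVec (f p) (star (f p)) := by
    ext i j
    simp [hA, Matrix.sum_apply, Matrix.vecMulVec_apply]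
  rw [h]
  exact Matrix.posSemidef_sum s fun p hp =>
    (Matrix.posSemidef_vecMulVec_self_star (f p)).smul (hw p hp)

/-- The easy half of the truncated moment problem: the moments of finitely many points of `[a, b]`
satisfy the Hankel conditions. -/
theorem posSemidef_hankelH {ι : Type*} (s : Finset ι) (t : ι → ℝ) (m : ℕ) (a b : EReal)
    (ht : ∀ p ∈ s, a ≤ (t p : EReal) ∧ (t p : EReal) ≤ b) (v : Fin (2 * m) → ℝ)
    (hv : ∀ k, v k = ∑ p ∈ s, t p ^ (k : ℕ)) : (hankelH m v a b).PosSemidef := by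
  refine posSemidef_fromBlocks_diag ?_ (posSemidef_fromBlocks_diag ?_ ?_)
  -- All three blocks are built from the vectors `(1, t, …, t^(m-1))`, with weights `1`, `t - a` and
  -- `b - t` respectively.
  · refine posSemidef_of_weighted_sum s (fun _ => 1) (by simp) (fun p (i : Fin m) => t p ^ (i : ℕ)) _ ?_
    intro i j
    simp [hankelR, hv, pow_add]
  · unfold hankelPlus
    split_ifs with h
    · exact .zero
    · refine posSemidef_of_weighted_sum s (fun p => t p - a.toReal) (fun p hp => ?_)
        (fun p (i : Fin m) => t p ^ (i : ℕ)) _ ?_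
      · push Not at h
        have := (ht p hp).1
        rw [← EReal.coe_toReal h.2 h.1, EReal.coe_le_coe_iff] at this
        linarith
      · intro i j
        simp only [Matrix.of_apply, hv, Finset.mul_sum, ← Finset.sum_sub_distrib]
        exact Finset.sum_congr rfl fun p _ => by ring
  · unfold hankelMinus
    split_ifs with h
    · exact .zero
    · refine posSemidef_of_weighted_sum s (fun p => b.toReal - t p) (fun p hp => ?_)
        (fun p (i : Fin m) => t p ^ (i : ℕ)) _ ?_
      · push Not at h
        have := (ht p hp).2
        rw [← EReal.coe_toReal h.2 h.1, EReal.coe_le_coe_iff] at this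
        linarith
      · intro i j
        simp only [Matrix.of_apply, hv, Finset.mul_sum, ← Finset.sum_sub_distrib]
        exact Finset.sum_congr rfl fun p _ => by ring

/-! ### Positive definiteness of zonal kernels -/

theorem tau_comm {M : Type*} [MetricSpace M] (F : ℝ → ℝ) (x y : M) : tau F x y = tau F y x := by
  rw [tau, tau, dist_comm]

theorem tau_self {M : Type*} [MetricSpace M] (F : ℝ → ℝ) (x : M) : tau F x x = F 0 := by
  rw [tau, dist_self]

/-- A nonnegative multiple of the Gram matrix `(∫ f i * f j)` is positive semidefinite. -/
theorem posSemidef_of_integral {M : Type*} [TopologicalSpace M] [CompactSpace M]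
    [MeasurableSpace M] [BorelSpace M] (μ : Measure M) [IsFiniteMeasure μ]
    {n : Type*} [Fintype n] (f : n → C(M, ℝ)) {κ : ℝ} (hκ : 0 ≤ κ) (A : Matrix n n ℝ)
    (hA : ∀ i j, A i j = κ * ∫ x, f i x * f j x ∂μ) : A.PosSemidef := by
  refine .of_dotProduct_mulVec_nonneg ?_ fun c => ?_
  · ext i j
    simp [hA, mul_comm]
  · have hint : ∀ i j, Integrable (fun x => c i * (f i x * f j x * c j)) μ := fun i j =>
      Continuous.integrable_of_hasCompactSupport (by fun_prop) (HasCompactSupport.of_compactSpace _)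
    -- The quadratic form is the integral of a square.
    have key : star c ⬝ᵥ A.mulVec c = κ * ∫ x, (∑ i, c i * f i x) ^ 2 ∂μ := by
      have : ∀ x, (∑ i, c i * f i x) ^ 2 = ∑ i, ∑ j, c i * (f i x * f j x * c j) := by
        intro x
        rw [sq, Finset.sum_mul_sum]
        exact Finset.sum_congr rfl fun i _ => Finset.sum_congr rfl fun j _ => by ring
      simp_rw [this]
      rw [integral_finsetSum _ fun i _ => integrable_finsetSum _ fun j _ => hint i j]
      simp only [dotProduct, Matrix.mulVec, star_trivial, hA, Finset.mul_sum]
      refine Finset.sum_congr rfl fun i _ => ?_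
      rw [integral_finsetSum _ fun j _ => hint i j, Finset.mul_sum]
      refine Finset.sum_congr rfl fun j _ => ?_
      rw [integral_const_mul, integral_mul_const]
      ring
    rw [key]
    exact mul_nonneg hκ (integral_nonneg fun x => sq_nonneg _)

/-- Zonal spherical functions are positive definite kernels, also after summation over sets of
points. -/
theorem IsZonalSpherical.posSemidef_sum {M : Type*} [MetricSpace M] [CompactSpace M]
    [MeasurableSpace M] [BorelSpace M] {μ : Measure M} [IsProbabilityMeasure μ] {F : ℝ → ℝ}
    {V : Submodule ℝ C(M, ℝ)} {φ : ℝ[X]} (h : IsZonalSpherical μ F V φ)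
    {n : Type*} [Fintype n] (T : n → Finset M) (A : Matrix n n ℝ)
    (hA : ∀ i j, A i j = ∑ u ∈ T i, ∑ v ∈ T j, φ.eval (tau F u v)) : A.PosSemidef := by
  choose z hz hzφ using h.mem
  obtain ⟨κ, hκ⟩ := h.reproducing
  -- The reproducing identity is applied to the kernel section `z u` itself, at the point `v`.
  have hker : ∀ u v, φ.eval (tau F u v) = κ * ∫ x, z u x * z v x ∂μ := by
    intro u v
    rw [tau_comm, ← hzφ, hκ _ (hz u)]
    simp_rw [hzφ]
  -- On the diagonal the kernel is `1`, so `1 = κ * ∫ (z y)²`, which excludes `κ < 0`.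
  have hκ0 : 0 ≤ κ := by
    obtain ⟨y⟩ : Nonempty M := nonempty_of_isProbabilityMeasure μ
    have h1 := hker y y
    rw [tau_self, h.normalized] at h1
    have h2 : 0 ≤ ∫ x, z y x * z y x ∂μ := integral_nonneg fun x => mul_self_nonneg _
    by_contra! hneg
    nlinarith [mul_nonneg (neg_nonneg.2 hneg.le) h2]
  refine posSemidef_of_integral μ (fun i => ∑ u ∈ T i, z u) hκ0 A fun i j => ?_
  have hint : ∀ u v, Integrable (fun x => z u x * z v x) μ := fun u v =>
    Continuous.integrable_of_hasCompactSupport (by fun_prop) (HasCompactSupport.of_compactSpace _)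
  simp only [ContinuousMap.coe_sum, Finset.sum_apply, Finset.sum_mul_sum]
  rw [hA, integral_finsetSum _ fun u _ => integrable_finsetSum _ fun v _ => hint u v,
    Finset.mul_sum]
  refine Finset.sum_congr rfl fun u _ => ?_
  rw [integral_finsetSum _ fun v _ => hint u v, Finset.mul_sum]
  exact Finset.sum_congr rfl fun v _ => hker u v

/-! ### The feasible point of a code -/

open Classical in
/-- The part `C ∩ Π_j` of a finite set. -/
noncomputable def codePart {M : Type*} {d : ℕ} (P : Fin d → Set M) (C : Finset M) (j : Fin d) :
    Finset M :=
  C.filter fun v => v ∈ P j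

theorem mem_codePart {M : Type*} {d : ℕ} {P : Fin d → Set M} {C : Finset M} {j : Fin d} {v : M} :
    v ∈ codePart P C j ↔ v ∈ C ∧ v ∈ P j := by
  simp [codePart]

theorem codeVars_eq {M : Type*} [MetricSpace M] (F : ℝ → ℝ) (m : ℕ) {r d : ℕ}
    (q : Fin r → M) (P : Fin d → Set M) (C : Finset M) :
    codeVars F m q P C = (fun j => ((codePart P C j).card : ℝ),
      fun (k : Fin (2 * m)) i j => ∑ u ∈ codePart P C i, ∑ v ∈ codePart P C j, tau F u v ^ (k : ℕ),
      fun (k : Fin (2 * m)) i j => ∑ v ∈ codePart P C j, tau F (q i) v ^ (k : ℕ)) :=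
  rfl

theorem sum_coeff_mul_pow_eq_eval {φ : ℝ[X]} {N : ℕ} (h : φ.natDegree < N) (t : ℝ) :
    ∑ l : Fin N, φ.coeff l * t ^ (l : ℕ) = φ.eval t := by
  rw [Polynomial.eval_eq_sum_range' h, ← Fin.sum_univ_eq_sum_range (fun l => φ.coeff l * t ^ l)]

theorem posSemidef_gammaMatrix_codeVars {M : Type*} [MetricSpace M] [CompactSpace M]
    [MeasurableSpace M] [BorelSpace M] {μ : Measure M} [IsProbabilityMeasure μ] {F : ℝ → ℝ}
    {V : Submodule ℝ C(M, ℝ)} {φ : ℝ[X]} (h : IsZonalSpherical μ F V φ) {m r d : ℕ}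
    (hdeg : φ.natDegree < 2 * m) (q : Fin r → M) (P : Fin d → Set M) (C : Finset M) :
    (gammaMatrix F φ q (codeVars F m q P C)).PosSemidef := by
  -- The singletons `{q i}` index the border and the parts of the code the remaining rows. Since
  -- `deg φ < 2m`, the available moments determine every entry.
  refine h.posSemidef_sum (Sum.elim (fun i => {q i}) (codePart P C)) _ ?_
  have hsum : ∀ s : Finset M, ∀ x : M, ∑ l : Fin (2 * m), φ.coeff l * ∑ v ∈ s,
      tau F x v ^ (l : ℕ) = ∑ v ∈ s, φ.eval (tau F x v) := by
    intro s x
    simp_rw [Finset.mul_sum]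
    rw [Finset.sum_comm]
    exact Finset.sum_congr rfl fun v _ => sum_coeff_mul_pow_eq_eval hdeg _
  rintro (i | i) (j | j)
  · simp [gammaMatrix]
  · simp [gammaMatrix, codeVars_eq, hsum]
  · simp [gammaMatrix, codeVars_eq, hsum, tau_comm F _ (q j)]
  · simp only [gammaMatrix, codeVars_eq, Matrix.fromBlocks_apply₂₂, Matrix.of_apply, Sum.elim_inr]
    simp_rw [← hsum]
    rw [Finset.sum_comm]
    simp_rw [Finset.mul_sum]

/-- The matrix is the rank-one square of the vector `(1, c)`. For a code, `x_{ij}^{(0)} = |C_i|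
|C_j|`. -/
theorem posSemidef_borderedMatrix {d : ℕ} (c : Fin d → ℝ) :
    (borderedMatrix c fun i j => c i * c j).PosSemidef := by
  refine posSemidef_of_weighted_sum {()} (fun _ => 1) (by simp)
    (fun _ => Sum.elim (fun _ => 1) c) _ ?_
  rintro (i | i) (j | j) <;> simp [borderedMatrix]

theorem sum_card_codePart {M : Type*} {d : ℕ} {P : Fin d → Set M} {C : Finset M}
    (hcover : (C : Set M) ⊆ ⋃ j, P j) (hdisj : ∀ i j, i ≠ j → Disjoint (P i) (P j)) :
    ∑ j, (codePart P C j).card = C.card := by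
  classical
  rw [← Finset.card_biUnion]
  · congr 1
    ext v
    simp only [Finset.mem_biUnion, Finset.mem_univ, true_and, mem_codePart]
    refine ⟨fun ⟨_, hv, _⟩ => hv, fun hv => ?_⟩
    obtain ⟨j, hj⟩ := Set.mem_iUnion.1 (hcover hv)
    exact ⟨j, hv, hj⟩
  · intro i _ j _ hij
    rw [Function.onFun, Finset.disjoint_left]
    intro v hi hj
    exact Set.disjoint_left.1 (hdisj i j hij) (mem_codePart.1 hi).2 (mem_codePart.1 hj).2

/-- The variables that come from a code are a feasible point of the program. -/
theorem Program.feasible_codeVars {G M : Type*} [Group G] [MetricSpace M] [CompactSpace M]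
    [MulAction G M] [MeasurableSpace M] [BorelSpace M] (μ : Measure M) [IsProbabilityMeasure μ]
    {r d : ℕ} (D : Program M r d) (hΦ : IsZonalFamily G μ D.F D.K D.Φ) (a b : ℝ)
    (Q : Fin d → Set M) (hdisj : ∀ i j, i ≠ j → Disjoint (Q i) (Q j))
    (hq : ∀ j, ∀ v ∈ Q j, ∀ i,
      D.α i j ≤ (tau D.F (D.q i) v : EReal) ∧ (tau D.F (D.q i) v : EReal) ≤ D.β i j)
    (hab : ∀ i j, i ≤ j → ∀ u ∈ Q i, ∀ v ∈ Q j, u ≠ v →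
      tau D.F u v ∈ Set.Icc a b → tau D.F u v ∈ Set.Icc (D.a i j) (D.b i j))
    (C : Finset M) (hC : IsCode D.F (Set.Icc a b) C)
    (hAd : (D.Ad (codeVars D.F D.m D.q Q C)).PosSemidef) :
    D.Feasible (codeVars D.F D.m D.q Q C) := by
  obtain ⟨V, -, -, -, hV, hdeg⟩ := hΦ
  have hbounds : ∀ i j, i ≤ j → ∀ u ∈ codePart Q C i, ∀ v ∈ codePart Q C j, u ≠ v →
      ((D.a i j : ℝ) : EReal) ≤ (tau D.F u v : EReal) ∧
        (tau D.F u v : EReal) ≤ ((D.b i j : ℝ) : EReal) := by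
    intro i j hij u hu v hv huv
    rw [mem_codePart] at hu hv
    have := hab i j hij u hu.2 v hv.2 huv (hC u hu.1 v hv.1 huv)
    exact ⟨EReal.coe_le_coe_iff.2 this.1, EReal.coe_le_coe_iff.2 this.2⟩
  constructor
  · intro k i j
    simp only [codeVars_eq]
    rw [Finset.sum_comm]
    simp_rw [tau_comm D.F]
  · intro k hk
    exact posSemidef_gammaMatrix_codeVars (hV k hk) (by rw [hdeg k hk]; exact k.2) D.q Q C
  · intro i j
    exact posSemidef_hankelH (codePart Q C j) (fun v => tau D.F (D.q i) v) _ _ _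
      (fun v hv => hq j v (mem_codePart.1 hv).2 i) _ fun k => rfl
  · intro i j hij
    refine posSemidef_hankelH (codePart Q C i ×ˢ codePart Q C j) (fun p => tau D.F p.1 p.2) _ _ _
      ?_ _ fun k => ?_
    · rintro ⟨u, v⟩ hp
      rw [Finset.mem_product] at hp
      refine hbounds i j hij.le u hp.1 v hp.2 ?_
      -- Points of different parts are distinct by disjointness, so the code condition bounds every
      -- pair.
      rintro rfl
      exact Set.disjoint_left.1 (hdisj i j hij.ne) (mem_codePart.1 hp.1).2 (mem_codePart.1 hp.2).2
    · simp only [codeVars_eq, Finset.sum_product]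
  · intro i
    classical
    refine posSemidef_hankelH (codePart Q C i).offDiag (fun p => tau D.F p.1 p.2) _ _ _
      ?_ _ fun k => ?_
    · rintro ⟨u, v⟩ hp
      rw [Finset.mem_offDiag] at hp
      exact hbounds i i le_rfl u hp.1 v hp.2.1 hp.2.2
    -- Subtracting `c_i τ_0^k` removes exactly the pairs `u = v`; what is left are moments of pairs
    -- of distinct code points.
    · have h := Finset.sum_union (Finset.disjoint_diag_offDiag (codePart Q C i))
        (f := fun p => tau D.F p.1 p.2 ^ (k : ℕ))
      rw [Finset.diag_union_offDiag, Finset.sum_product, Finset.sum_diag] at h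
      simp only [tau_self, Finset.sum_const, nsmul_eq_mul] at h
      simp only [codeVars_eq]
      linarith
  · exact hAd
  · intro i j
    simp [codeVars_eq, zeroIdx]
  · intro j
    simp [codeVars_eq]
  · convert posSemidef_borderedMatrix (codeVars D.F D.m D.q Q C).1 using 2
    ext i j
    simp [codeVars_eq, zeroIdx]

theorem maxCode_le {M : Type*} [MetricSpace M] {F : ℝ → ℝ} {S : Set ℝ} {P : Set M} {B : EReal}
    (h : ∀ C : Finset M, (C : Set M) ⊆ P → IsCode F S C → ((C.card : ℝ) : EReal) ≤ B) :
    ((maxCode F S P : ℝ≥0∞) : EReal) ≤ B := by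
  -- The empty code gives `0 ≤ B`, so the comparison can be moved to `ℝ≥0∞`, where the supremum is
  -- taken.
  have hB : 0 ≤ B := by simpa using h ∅ (by simp) (by simp [IsCode])
  rw [← EReal.coe_toENNReal hB, EReal.coe_ennreal_le_coe_ennreal_iff, maxCode]
  simp only [ENat.toENNReal_iSup, iSup_le_iff]
  rintro C ⟨hP, hS⟩
  rw [← EReal.coe_ennreal_le_coe_ennreal_iff, EReal.coe_toENNReal hB]
  exact_mod_cast h C hP hS

end CodeSDP

theorem theorem7p3 {G M : Type*} [Group G] [MetricSpace M] [CompactSpace M] [MulAction G M]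
    [MeasurableSpace M] [BorelSpace M]
    (hM : CodeSDP.IsTwoPointHomogeneous G M)
    (μ : Measure M) [IsProbabilityMeasure μ] [SMulInvariantMeasure G M μ]
    {r d : ℕ} (D : CodeSDP.Program M r d)
    (hΦ : CodeSDP.IsZonalFamily G μ D.F D.K D.Φ)
    (a b : ℝ) (S : Set ℝ) (hS : S = CodeSDP.tauValues M D.F ∩ Set.Icc a b)
    (P : Set M) (Q : Fin d → Set M)
    (hcover : P ⊆ ⋃ j, Q j)
    (hdisj : ∀ i j, i ≠ j → Disjoint (Q i) (Q j))
    (hq : ∀ j, ∀ v ∈ Q j, ∀ i,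
      D.α i j ≤ (CodeSDP.tau D.F (D.q i) v : EReal) ∧
      (CodeSDP.tau D.F (D.q i) v : EReal) ≤ D.β i j)
    (hab : ∀ i j, i ≤ j → ∀ u ∈ Q i, ∀ v ∈ Q j, u ≠ v →
      CodeSDP.tau D.F u v ∈ Set.Icc a b → CodeSDP.tau D.F u v ∈ Set.Icc (D.a i j) (D.b i j))
    (hAd : ∀ C : Finset M, (C : Set M) ⊆ P → CodeSDP.IsCode D.F S C →
      (D.Ad (CodeSDP.codeVars D.F D.m D.q Q C)).PosSemidef) :
    ((CodeSDP.maxCode D.F S P : ℝ≥0∞) : EReal) ≤ D.cStar := by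
  subst hS
  refine CodeSDP.maxCode_le fun C hCP hC => ?_
  have hfeas := D.feasible_codeVars μ hΦ a b Q hdisj hq hab C
    (fun x hx y hy hxy => (hC x hx y hy hxy).2) (hAd C hCP hC)
  refine le_trans (le_of_eq ?_) (le_iSup₂ (f := fun (v : CodeSDP.Vars D.m r d)
    (_ : D.Feasible v) => ((∑ j, v.1 j : ℝ) : EReal)) _ hfeas)
  rw [← CodeSDP.sum_card_codePart (hCP.trans hcover) hdisj]
  simp [CodeSDP.codeVars_eq]
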